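/- Let $(\Gamma,+,0,\le)$ be a divisible totally ordered abelian group (possibly trivial). Let $\mathbb{T}_{\max}=\Gamma\cup\{\bot\}$ be the tropical semifield, with $a\oplus b=\max(a,b)$, $a\odot b=a+b$ and zero element $\bot$. Let $\mathbb{S}_{\max}$ be the symmetrized tropical semiring, that is the quotient of $\mathbb{T}_{\max}^2$, with operations $(a_1,a_2)\oplus(b_1,b_2)=(a_1\oplus b_1,a_2\oplus b_2)$ and $(a_1,a_2)\odot(b_1,b_2)=(a_1b_1\oplus a_2b_2,\,a_1b_2\oplus a_2b_1)$, by the congruence that identifies $(a_1,a_2)$ and $(b_1,b_2)$ if they are equal, or if $a_1\ne a_2$, $b_1\neq b_2$ and $a_1\oplus b_2=a_2\oplus b_1$. On classes put $\ominus(a_1,a_2)=(a_2,a_1)$, $|(a_1,a_2)|=a_1\oplus a_2\in\mathbb{T}_{\max}$, and $(a_1,a_2)\,\nabla\,(b_1,b_2)$ iff $a_1\oplus b_2=a_2\oplus b_1$. Let $\mathbb{S}_{\max}^\vee$ be the set of signed elements, that is the classes of $(c,\bot)$ and $(\bot,c)$ with $c\in\mathbb{T}_{\max}$. The relation $\nabla$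 and the map $|\cdot|$ are applied to formal polynomials coefficientwise. For a formal polynomial $P$ with coefficients in $\mathbb{S}_{\max}^\vee$, a root of $P$ is an $r\in\mathbb{S}_{\max}^\vee$ with $\widehat P(r)\,\nabla\,\mathbb{0}$, where $\widehat P$ is the polynomial function of $P$. For nonzero $P$ and $r\in\mathbb{S}_{\max}^\vee$, the multiplicity $\mathrm{mult}_r(P)$ is $0$ if $r$ is not a root of $P$, and otherwise $$\mathrm{mult}_r(P)=1+\max\{\mathrm{mult}_r(Q)\mid Q\in\mathbb{S}_{\max}^\vee[\mathsf Y],\ \lambda\in\mathbb{S}_{\max}^\vee\setminus\{\mathbb{0}\},\ \lambda P\,\nabla\,(\mathsf Y\ominus r)Q\}.$$ For a nonzero formal polynomial $p=\bigoplus_k p_k\mathsf Y^k$ over $\mathbb{T}_{\max}$, an element $c\neq\bot$ is a corner of $p$ if the maximum $\max_k(p_k+kc)$ is attained by at least two monomials, and its multiplicity is the largest minus the smallest exponent attaining it; $\bot$ is a corner of $p$ if $p_0=\bot$, and its multiplicity is the smallest exponent $k$ with $p_k\ne\bot$. Let $P$ be a formal polynomial of degree $n\ge 0$ (in particular $P\neq\mathbb{0}$)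 with coefficients in $\mathbb{S}_{\max}^\vee$. Then: 1. for every root $r\in\mathbb{S}_{\max}^\vee$ of $P$, $|r|$ is a corner of $|P|$, and $\mathrm{mult}_r(P)$ is at most the multiplicity of $|r|$ as a corner of $|P|$; 2. for every root $r\neq\mathbb{0}$ of $P$, $\mathrm{mult}_r(P)+\mathrm{mult}_{\ominus r}(P)$ is at most the multiplicity of $|r|$ as a corner of $|P|$; 3. $P$ has at most $n$ roots counted with multiplicity: the set of its roots in $\mathbb{S}_{\max}^\vee$ is finite and $\sum_{r}\mathrm{mult}_r(P)\le n$, the sum being over all roots $r$ of $P$. -/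

import Mathlib

open Polynomial

/-! ### The tropical semifield over an ordered abelian group -/

/-- The tropical (max-plus) semifield `Γ ∪ {⊥}` over a totally ordered abelian group `Γ`:
addition is the maximum, multiplication is the addition of `Γ`, with `⊥` absorbing. -/
def TMax (Γ : Type*) : Type _ := WithBot Γ

namespace TMax

variable {Γ : Type*} [AddCommGroup Γ] [LinearOrder Γ] [IsOrderedAddMonoid Γ]

noncomputable instance : LinearOrder (TMax Γ) := inferInstanceAs (LinearOrder (WithBot Γ))

/-- The element of `TMax Γ` given by an element of `Γ ∪ {⊥}`. -/
def of (a : WithBot Γ) : TMax Γ := a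

/-- The element of `Γ ∪ {⊥}` underlying an element of `TMax Γ`. -/
def val (a : TMax Γ) : WithBot Γ := a

noncomputable instance : Add (TMax Γ) := ⟨fun a b => max a b⟩
noncomputable instance : Mul (TMax Γ) := ⟨fun a b => of (a.val + b.val)⟩
instance : Zero (TMax Γ) := ⟨of ⊥⟩
instance : One (TMax Γ) := ⟨of 0⟩

noncomputable instance : CommSemiring (TMax Γ) where
  nsmul := nsmulRec
  npow := npowRec
  add_assoc a b c := max_assoc a b c
  zero_add a := max_eq_right (bot_le (α := WithBot Γ) (a := a))
  add_zero a := max_eq_left (bot_le (α := WithBot Γ) (a := a))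
  add_comm a b := max_comm a b
  left_distrib a b c := (max_add_add_left a.val b.val c.val).symm
  right_distrib a b c := (max_add_add_right a.val b.val c.val).symm
  zero_mul a := WithBot.bot_add a.val
  mul_zero a := WithBot.add_bot a.val
  mul_assoc a b c := add_assoc a.val b.val c.val
  one_mul a := zero_add a.val
  mul_one a := add_zero a.val
  mul_comm a b := add_comm a.val b.val

theorem add_eq_max (a b : TMax Γ) : a + b = max a b := rfl

theorem zero_le (a : TMax Γ) : 0 ≤ a := bot_le (α := WithBot Γ) (a := a)

theorem mul_lt_mul_right_of_ne {a b c : TMax Γ} (hc : c ≠ 0) (h : a < b) : a * c < b * c :=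
  WithBot.add_lt_add_right (α := Γ) (x := a.val) (y := b.val) (z := c.val) hc h

theorem mul_le_mul_right_of_le {a b : TMax Γ} (c : TMax Γ) (h : a ≤ b) : a * c ≤ b * c := by
  rw [← max_eq_right h, ← add_eq_max, add_mul, add_eq_max]
  exact le_max_left _ _

end TMax

/-! ### The symmetrized tropical semiring -/

/-- Pairs of elements of `TMax Γ`. -/
@[ext] structure TPair (Γ : Type*) where
  fst : TMax Γ
  snd : TMax Γ

namespace TPair

variable {Γ : Type*} [AddCommGroup Γ] [LinearOrder Γ] [IsOrderedAddMonoid Γ]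

noncomputable instance : Add (TPair Γ) := ⟨fun a b => ⟨a.fst + b.fst, a.snd + b.snd⟩⟩
noncomputable instance : Mul (TPair Γ) :=
  ⟨fun a b => ⟨a.fst * b.fst + a.snd * b.snd, a.fst * b.snd + a.snd * b.fst⟩⟩
noncomputable instance : Zero (TPair Γ) := ⟨⟨0, 0⟩⟩
noncomputable instance : One (TPair Γ) := ⟨⟨1, 0⟩⟩

@[simp] theorem add_fst (a b : TPair Γ) : (a + b).fst = a.fst + b.fst := rfl
@[simp] theorem add_snd (a b : TPair Γ) : (a + b).snd = a.snd + b.snd := rfl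
@[simp] theorem mul_fst (a b : TPair Γ) : (a * b).fst = a.fst * b.fst + a.snd * b.snd := rfl
@[simp] theorem mul_snd (a b : TPair Γ) : (a * b).snd = a.fst * b.snd + a.snd * b.fst := rfl
@[simp] theorem zero_fst : (0 : TPair Γ).fst = 0 := rfl
@[simp] theorem zero_snd : (0 : TPair Γ).snd = 0 := rfl
@[simp] theorem one_fst : (1 : TPair Γ).fst = 1 := rfl
@[simp] theorem one_snd : (1 : TPair Γ).snd = 0 := rfl

noncomputable instance : CommSemiring (TPair Γ) where
  nsmul := nsmulRec
  npow := npowRec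
  add_assoc a b c := by ext <;> simp [add_assoc]
  zero_add a := by ext <;> simp
  add_zero a := by ext <;> simp
  add_comm a b := by ext <;> simp [add_comm]
  left_distrib a b c := by ext <;> simp <;> ring
  right_distrib a b c := by ext <;> simp <;> ring
  zero_mul a := by ext <;> simp
  mul_zero a := by ext <;> simp
  mul_assoc a b c := by ext <;> simp <;> ring
  one_mul a := by ext <;> simp
  mul_one a := by ext <;> simp
  mul_comm a b := by ext <;> simp <;> ring

/-- The minus operator `⊖ (a₁, a₂) = (a₂, a₁)`. -/
def neg (a : TPair Γ) : TPair Γ := ⟨a.snd, a.fst⟩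

/-- The absolute value `|(a₁, a₂)| = a₁ ⊕ a₂`. -/
noncomputable def abs (a : TPair Γ) : TMax Γ := a.fst + a.snd

/-- The balance relation `a₁ ⊕ b₂ = a₂ ⊕ b₁` on pairs. -/
def Balances (a b : TPair Γ) : Prop := a.fst + b.snd = a.snd + b.fst

/-- The equivalence relation whose quotient is the symmetrized tropical semiring. -/
def Rel (a b : TPair Γ) : Prop :=
  (a.fst ≠ a.snd ∧ b.fst ≠ b.snd ∧ a.fst + b.snd = a.snd + b.fst) ∨
    (¬ (a.fst ≠ a.snd ∧ b.fst ≠ b.snd) ∧ a = b)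

theorem rel_iff (a b : TPair Γ) : Rel a b ↔ a = b ∨
    (a.fst < a.snd ∧ b.fst < b.snd ∧ a.snd = b.snd) ∨
    (a.snd < a.fst ∧ b.snd < b.fst ∧ a.fst = b.fst) := by
  obtain ⟨a1, a2⟩ := a
  obtain ⟨b1, b2⟩ := b
  simp only [Rel, TMax.add_eq_max, TPair.mk.injEq]
  grind

theorem rel_equivalence : Equivalence (Rel (Γ := Γ)) where
  refl a := by rw [rel_iff]; exact Or.inl rfl
  symm := by
    intro a b
    simp only [rel_iff, TPair.ext_iff]
    grind
  trans := by
    intro a b c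
    simp only [rel_iff, TPair.ext_iff]
    grind

theorem Rel.neg {a b : TPair Γ} (h : Rel a b) : Rel a.neg b.neg := by
  simp only [rel_iff, TPair.ext_iff, TPair.neg] at h ⊢
  grind

theorem Rel.abs {a b : TPair Γ} (h : Rel a b) : a.abs = b.abs := by
  simp only [rel_iff, TPair.ext_iff, TPair.abs, TMax.add_eq_max] at h ⊢
  grind

theorem Rel.balances {a a' b b' : TPair Γ} (h : Rel a a') (h' : Rel b b') :
    Balances a b ↔ Balances a' b' := by
  simp only [rel_iff, TPair.ext_iff, Balances, TMax.add_eq_max] at h h' ⊢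
  grind

theorem Rel.add_right {a b : TPair Γ} (h : Rel a b) (c : TPair Γ) : Rel (a + c) (b + c) := by
  simp only [rel_iff, TPair.ext_iff, add_fst, add_snd, TMax.add_eq_max] at h ⊢
  grind

theorem rel_mul_aux {a b c : TPair Γ} (ha : a.fst < a.snd) (hb : b.fst < b.snd)
    (hab : a.snd = b.snd) : Rel (a * c) (b * c) := by
  obtain ⟨a1, a2⟩ := a
  obtain ⟨b1, b2⟩ := b
  obtain ⟨c1, c2⟩ := c
  simp only at ha hb hab
  subst hab
  have ha2 : a2 ≠ 0 := ((TMax.zero_le a1).trans_lt ha).ne'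
  have lt_mul : ∀ x y z : TMax Γ, x < y → z ≠ 0 → x * z < y * z :=
    fun x y z h hz => TMax.mul_lt_mul_right_of_ne hz h
  have le_mul : ∀ x y z : TMax Γ, x ≤ y → x * z ≤ y * z :=
    fun x y z h => TMax.mul_le_mul_right_of_le z h
  simp only [rel_iff, TPair.ext_iff, mul_fst, mul_snd, TMax.add_eq_max]
  rcases lt_trichotomy c1 c2 with hc | hc | hc
  · have h0 : c2 ≠ 0 := ((TMax.zero_le c1).trans_lt hc).ne'
    have h1 := lt_mul _ _ _ ha h0
    have h2 := lt_mul _ _ _ hb h0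
    have h3 := lt_mul _ _ _ hc ha2
    have h4 := le_mul _ _ c1 ha.le
    have h5 := le_mul _ _ c1 hb.le
    rw [mul_comm c1, mul_comm c2] at h3
    grind
  · subst hc
    have h4 := le_mul _ _ c1 ha.le
    have h5 := le_mul _ _ c1 hb.le
    grind
  · have h0 : c1 ≠ 0 := ((TMax.zero_le c2).trans_lt hc).ne'
    have h1 := lt_mul _ _ _ ha h0
    have h2 := lt_mul _ _ _ hb h0
    have h3 := lt_mul _ _ _ hc ha2
    have h4 := le_mul _ _ c2 ha.le
    have h5 := le_mul _ _ c2 hb.le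
    rw [mul_comm c1, mul_comm c2] at h3
    grind

theorem Rel.mul_right {a b : TPair Γ} (h : Rel a b) (c : TPair Γ) : Rel (a * c) (b * c) := by
  rcases (rel_iff a b).1 h with h | ⟨h1, h2, h3⟩ | ⟨h1, h2, h3⟩
  · rw [h]; exact rel_equivalence.refl _
  · exact rel_mul_aux h1 h2 h3
  · have := (rel_mul_aux (a := a.neg) (b := b.neg) (c := c) h1 h2 h3).neg
    have e : ∀ x : TPair Γ, (x.neg * c).neg = x * c := fun x => by
      ext <;> simp [TPair.neg, add_comm]
    rwa [e, e] at this

theorem abs_add (a b : TPair Γ) : (a + b).abs = a.abs + b.abs := by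
  simp only [TPair.abs, add_fst, add_snd]; ring

theorem abs_mul (a b : TPair Γ) : (a * b).abs = a.abs * b.abs := by
  simp only [TPair.abs, mul_fst, mul_snd]; ring

end TPair

/-- The relation `TPair.Rel` as a congruence of the semiring of pairs. -/
def TPair.con (Γ : Type*) [AddCommGroup Γ] [LinearOrder Γ] [IsOrderedAddMonoid Γ] :
    RingCon (TPair Γ) where
  r := TPair.Rel
  iseqv := TPair.rel_equivalence
  add' {a b c d} h h' := by
    have h1 := h'.add_right b
    rw [add_comm c, add_comm d] at h1
    exact TPair.rel_equivalence.trans (h.add_right c) h1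
  mul' {a b c d} h h' := by
    have h1 := h'.mul_right b
    rw [mul_comm c, mul_comm d] at h1
    exact TPair.rel_equivalence.trans (h.mul_right c) h1

/-- The symmetrized tropical semiring over `Γ`. -/
def SMax (Γ : Type*) [AddCommGroup Γ] [LinearOrder Γ] [IsOrderedAddMonoid Γ] : Type _ :=
  (TPair.con Γ).Quotient

namespace SMax

variable {Γ : Type*} [AddCommGroup Γ] [LinearOrder Γ] [IsOrderedAddMonoid Γ]

noncomputable instance : CommSemiring (SMax Γ) :=
  inferInstanceAs (CommSemiring (TPair.con Γ).Quotient)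

/-- The class of a pair, as a morphism of semirings. -/
noncomputable def mk : TPair Γ →+* SMax Γ := (TPair.con Γ).mk'

/-- The minus operator `⊖` of the symmetrized tropical semiring. -/
def neg : SMax Γ → SMax Γ := Quotient.map TPair.neg fun _ _ h => TPair.Rel.neg h

/-- The absolute value, a morphism of semirings to `TMax Γ`. -/
noncomputable def abs : SMax Γ →+* TMax Γ where
  toFun := Quotient.lift TPair.abs fun _ _ h => TPair.Rel.abs h
  map_one' := by
    change TPair.abs (1 : TPair Γ) = 1
    simp [TPair.abs]
  map_zero' := by
    change TPair.abs (0 : TPair Γ) = 0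
    simp [TPair.abs]
  map_add' a b := by
    induction a, b using Quotient.inductionOn₂ with
    | h a b => exact TPair.abs_add a b
  map_mul' a b := by
    induction a, b using Quotient.inductionOn₂ with
    | h a b => exact TPair.abs_mul a b

/-- The balance relation `∇` of the symmetrized tropical semiring. -/
def Balances : SMax Γ → SMax Γ → Prop :=
  Quotient.lift₂ TPair.Balances fun _ _ _ _ h h' => propext (TPair.Rel.balances h h')

/-- Signed elements: the classes of `(c, ⊥)` (positive or zero) and of `(⊥, c)`
(negative or zero). -/
def IsSigned (a : SMax Γ) : Prop := ∃ c : TMax Γ, a = mk ⟨c, 0⟩ ∨ a = mk ⟨0, c⟩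

/-- Formal polynomials all of whose coefficients are signed. -/
def IsSignedPoly (P : (SMax Γ)[X]) : Prop := ∀ k, IsSigned (P.coeff k)

/-- `r` is a (signed) root of `P`: it is signed and the value of `P` at `r` balances zero. -/
def IsSignedRoot (P : (SMax Γ)[X]) (r : SMax Γ) : Prop :=
  IsSigned r ∧ Balances (P.eval r) 0

/-- `Q` is obtained from `P` by dividing out the linear factor `Y ⊖ a` up to balance:
`Q` has signed coefficients and `lam P ∇ (Y ⊖ a) Q`, coefficient by coefficient, for some
nonzero signed `lam`. -/
def IsQuotient (a : SMax Γ) (P Q : (SMax Γ)[X]) : Prop :=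
  IsSignedPoly Q ∧ ∃ lam : SMax Γ, IsSigned lam ∧ lam ≠ 0 ∧
    ∀ k, Balances ((C lam * P).coeff k) (((X + C (neg a)) * Q).coeff k)

open Classical in
/-- The right-hand side of the recursion that defines the multiplicity of a root. -/
noncomputable def multStep (a : SMax Γ) : ((SMax Γ)[X] → ℕ∞) →o ((SMax Γ)[X] → ℕ∞) where
  toFun m P := if IsSignedRoot P a then 1 + ⨆ Q : {Q // IsQuotient a P Q}, m Q else 0
  monotone' m m' h P := by
    dsimp only
    split_ifs
    · exact add_le_add le_rfl (iSup_mono fun Q => h Q)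
    · exact le_rfl

/-- The multiplicity `mult_a(P)`: the function given by the recursion `rootMult_eq` below.
(A quotient of a nonzero `P` has degree `deg P - 1`, so for `P ≠ 0` the recursion determines the
value; for the zero polynomial, of which zero is a quotient, the value is `⊤`.) -/
noncomputable def rootMult (a : SMax Γ) : (SMax Γ)[X] → ℕ∞ := (multStep a).lfp

open Classical in
/-- `mult_a(P) = 0` if `a` is not a root of `P`, and otherwise `mult_a(P)` is one plus the
largest `mult_a(Q)` with `lam P ∇ (Y ⊖ a) Q`. -/
theorem rootMult_eq (a : SMax Γ) (P : (SMax Γ)[X]) :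
    rootMult a P =
      if IsSignedRoot P a then 1 + ⨆ Q : {Q // IsQuotient a P Q}, rootMult a Q else 0 :=
  (congrFun (multStep a).map_lfp P).symm

end SMax

/-! ### Corners of tropical polynomials -/

namespace TMax

variable {Γ : Type*} [AddCommGroup Γ] [LinearOrder Γ] [IsOrderedAddMonoid Γ]

/-- The exponents of the monomials of `p` that attain the maximum `p(c) = max_k (p_k + k c)`. -/
noncomputable def maxExponents (p : (TMax Γ)[X]) (c : TMax Γ) : Finset ℕ :=
  p.support.filter fun k => p.coeff k * c ^ k = p.eval c

open Classical in
/-- A nonzero `c` is a corner of `p` if at least two monomials attain the maximum at `c`; zero is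
a corner if `p` has no constant term. -/
def IsCorner (p : (TMax Γ)[X]) (c : TMax Γ) : Prop :=
  if c = 0 then p.coeff 0 = 0 else 2 ≤ (maxExponents p c).card

open Classical in
/-- The multiplicity of a corner `c` of `p`: the lower degree of `p` if `c` is zero, and the
largest minus the smallest exponent attaining the maximum at `c` otherwise. -/
noncomputable def cornerMult (p : (TMax Γ)[X]) (c : TMax Γ) : ℕ :=
  if c = 0 then p.natTrailingDegree
  else sSup (maxExponents p c : Set ℕ) - sInf (maxExponents p c : Set ℕ)

end TMax

/-!
Replacing `Y` by `rY` reduces to the root `1`. Keep only the coefficients of `P(rY)` of maximal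
absolute value, and of these only the signs. A relation `λP ∇ (Y ⊖ r)Q` then says that, at each
exponent, the signs of `P`, `-YQ` and `Q` sum to zero in the hyperfield of signs. Such a relation
lifts to an honest product `(Y - 1)q` over `ℚ`, by choosing the coefficients of `q` one after
another, so Descartes' rule of signs shows that every division costs a sign change. The sign
changes of a real polynomial `p(Y)` and of `p(-Y)` together number at most the length of the
support, which here is the multiplicity of the corner `|r|`. Finally, the corners correspond to
disjoint intervals of exponents, one for each slope of the Newton polygon.
-/

/-! ### Sign variations -/

theorem signVariations_congr {R S : Type*} [Semiring R] [LinearOrder R] [Semiring S]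
    [LinearOrder S] {p : R[X]} {q : S[X]}
    (h : ∀ k, SignType.sign (p.coeff k) = SignType.sign (q.coeff k)) :
    p.signVariations = q.signVariations := by
  have hsupp : p.support = q.support := by
    ext k
    rw [mem_support_iff, mem_support_iff, ← sign_ne_zero, h k, sign_ne_zero]
  have hsigns : SignType.sign ∘ p.coeff = SignType.sign ∘ q.coeff := funext h
  simp only [signVariations, coeffList, degree, hsupp, List.map_map, hsigns]

theorem coeff_comp_neg_X {R : Type*} [Ring R] (p : R[X]) (k : ℕ) :
    (p.comp (-X)).coeff k = p.coeff k * (-1) ^ k := by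
  rw [← comp_C_mul_X_coeff, C_neg, C_1, neg_one_mul]

theorem natDegree_comp_neg_X {R : Type*} [Ring R] (p : R[X]) :
    (p.comp (-X)).natDegree = p.natDegree :=
  natDegree_eq_of_degree_eq degree_comp_neg_X

theorem eraseLead_comp_neg_X {R : Type*} [Ring R] (p : R[X]) :
    (p.comp (-X)).eraseLead = p.eraseLead.comp (-X) := by
  ext k
  simp only [eraseLead_coeff, coeff_comp_neg_X, natDegree_comp_neg_X, ite_mul, zero_mul]

section SignVariations

variable {R : Type*} [Ring R] [LinearOrder R]

theorem sign_eq_sign_leadingCoeff_of_signVariations_eq_zero {p : R[X]}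
    (hp : p.signVariations = 0) {k : ℕ} (hk : p.coeff k ≠ 0) :
    SignType.sign (p.coeff k) = SignType.sign p.leadingCoeff := by
  induction hcard : p.support.card using Nat.strong_induction_on generalizing p with | _ c ih =>
  have hp0 : p ≠ 0 := by rintro rfl; simp at hk
  obtain rfl | hkd := eq_or_ne k p.natDegree
  · rfl
  have hke : p.eraseLead.coeff k ≠ 0 := by rwa [eraseLead_coeff_of_ne _ hkd]
  rw [signVariations_eq_eraseLead_add_ite hp0, Nat.add_eq_zero_iff] at hp
  have hlead : SignType.sign p.leadingCoeff ≠ -SignType.sign p.eraseLead.leadingCoeff := by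
    simpa using hp.2
  have hrec := ih _ (hcard ▸ eraseLead_support_card_lt hp0) hp.1 hke rfl
  rw [eraseLead_coeff_of_ne _ hkd] at hrec
  have hne := sign_ne_zero.2 (leadingCoeff_ne_zero.2 hp0)
  have hk' := sign_ne_zero.2 hk
  rw [hrec] at hk' ⊢
  revert hlead hne hk'
  generalize SignType.sign p.leadingCoeff = a
  generalize SignType.sign p.eraseLead.leadingCoeff = b
  decide +revert

theorem signVariations_pos {p : R[X]} {i j : ℕ} (hi : 0 < p.coeff i) (hj : p.coeff j < 0) :
    0 < p.signVariations := by
  refine Nat.pos_of_ne_zero fun h => ?_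
  have hij := (sign_eq_sign_leadingCoeff_of_signVariations_eq_zero h hi.ne').trans
    (sign_eq_sign_leadingCoeff_of_signVariations_eq_zero h hj.ne).symm
  rw [sign_pos hi, sign_neg hj] at hij
  exact absurd hij (by decide)

theorem natTrailingDegree_le_natTrailingDegree_eraseLead {S : Type*} [Semiring S] {p : S[X]}
    (hp : p.eraseLead ≠ 0) : p.natTrailingDegree ≤ p.eraseLead.natTrailingDegree := by
  refine le_natTrailingDegree hp fun k hk => ?_
  rw [eraseLead_coeff, coeff_eq_zero_of_lt_natTrailingDegree hk, ite_self]

theorem sign_neg_one_pow_succ_mul_ne [IsStrictOrderedRing R] {a b : R} (hb : b ≠ 0)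
    (hab : SignType.sign a = -SignType.sign b) (n : ℕ) :
    SignType.sign ((-1) ^ (n + 1) * a) ≠ -SignType.sign ((-1) ^ n * b) := by
  have hb' := sign_ne_zero.2 hb
  have hneg : SignType.sign (-1 : R) = -1 := sign_neg (neg_lt_zero.2 one_pos)
  simp only [sign_mul, sign_pow, hneg, hab, pow_succ]
  generalize SignType.sign b = s at hb' ⊢
  obtain h | h := neg_one_pow_eq_or SignType n <;> rw [h] <;> revert hb' <;> revert s <;> decide

theorem signVariations_add_signVariations_comp_neg_X_le [IsStrictOrderedRing R] (p : R[X]) :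
    p.signVariations + (p.comp (-X)).signVariations ≤ p.natDegree - p.natTrailingDegree := by
  induction hcard : p.support.card using Nat.strong_induction_on generalizing p with | _ c ih =>
  obtain rfl | hp := eq_or_ne p 0
  · simp
  have hrec := ih _ (hcard ▸ eraseLead_support_card_lt hp) _ rfl
  rw [signVariations_eq_eraseLead_add_ite hp,
    signVariations_eq_eraseLead_add_ite (comp_neg_X_eq_zero_iff.not.2 hp), eraseLead_comp_neg_X,
    comp_neg_X_leadingCoeff_eq, comp_neg_X_leadingCoeff_eq]
  obtain he | he := eq_or_ne p.eraseLead 0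
  · simp [he, hp]
  have hlt : p.eraseLead.natDegree < p.natDegree :=
    (eraseLead_natDegree_lt_or_eraseLead_eq_zero p).resolve_right he
  have htrail := natTrailingDegree_le_natTrailingDegree_eraseLead he
  have hle := p.eraseLead.natTrailingDegree_le_natDegree
  -- Across a gap of one degree, only one of `p` and `p.comp (-X)` can change sign.
  have hparity := sign_neg_one_pow_succ_mul_ne (a := p.leadingCoeff) (leadingCoeff_ne_zero.2 he)
  split_ifs with h h' <;> try lia
  have hgap : p.natDegree ≠ p.eraseLead.natDegree + 1 := fun hd => hparity h _ (hd ▸ h')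
  lia

end SignVariations

/-! ### The hyperfield of signs -/

/-- The sum of three signs contains zero in the hyperfield of signs: a positive term occurs if and
only if a negative term does. -/
def SignsBalance (a b c : SignType) : Prop :=
  (a = 1 ∨ b = 1 ∨ c = 1) ↔ (a = -1 ∨ b = -1 ∨ c = -1)

instance (a b c : SignType) : Decidable (SignsBalance a b c) :=
  inferInstanceAs (Decidable (_ ↔ _))

theorem SignsBalance.eq_zero {a : SignType} (h : SignsBalance a (-0) 0) : a = 0 := by
  revert a; decide

section Lift

variable {K : Type*} [Field K] [LinearOrder K] [IsStrictOrderedRing K]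

theorem exists_lt_sign_eq {β : K} {y : SignType} (h : y = -1 ∨ SignType.sign β = 1) :
    ∃ γ < β, SignType.sign γ = y := by
  by_cases hy : y = -1
  · refine ⟨min β 0 - 1, ?_, ?_⟩
    · exact (sub_one_lt _).trans_le (min_le_left _ _)
    · rw [hy, sign_eq_neg_one_iff]
      exact (sub_one_lt _).trans_le (min_le_right _ _)
  · have hβ : 0 < β := sign_eq_one_iff.1 (h.resolve_left hy)
    cases y with
    | zero => exact ⟨0, hβ, sign_zero⟩
    | neg => exact absurd rfl hy
    | pos => exact ⟨β / 2, half_lt_self hβ, sign_pos (half_pos hβ)⟩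

theorem exists_gt_sign_eq {β : K} {y : SignType} (h : y = 1 ∨ SignType.sign β = -1) :
    ∃ γ > β, SignType.sign γ = y := by
  obtain ⟨γ, hγ, hy⟩ := exists_lt_sign_eq (β := -β) (y := -y)
    (h.imp (congrArg Neg.neg) fun hβ => by rw [Left.sign_neg, hβ, neg_neg])
  exact ⟨-γ, lt_neg.1 hγ, by rw [Left.sign_neg, hy, neg_neg]⟩

theorem SignsBalance.exists_sign_eq_and_sign_sub_eq {β : K} {a y : SignType}
    (h : SignsBalance a (-SignType.sign β) y) :
    ∃ γ : K, SignType.sign γ = y ∧ SignType.sign (β - γ) = a := by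
  generalize hs : SignType.sign β = s at h
  cases a with
  | zero =>
    have hy : s = y := by clear hs; revert s y; decide
    exact ⟨β, hs.trans hy, by rw [sub_self, sign_zero]; rfl⟩
  | pos =>
    obtain ⟨γ, hγ, hy⟩ := exists_lt_sign_eq (β := β) (y := y)
      (by rw [hs]; clear hs; revert s y; decide)
    exact ⟨γ, hy, sign_pos (sub_pos.2 hγ)⟩
  | neg =>
    obtain ⟨γ, hγ, hy⟩ := exists_gt_sign_eq (β := β) (y := y)
      (by rw [hs]; clear hs; revert s y; decide)
    exact ⟨γ, hy, sign_neg (sub_neg.2 hγ)⟩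

theorem exists_sign_coeff_eq_and_sign_coeff_X_sub_one_mul_eq {p q : K[X]}
    (h : ∀ k, SignsBalance (SignType.sign (p.coeff k)) (-SignType.sign ((X * q).coeff k))
      (SignType.sign (q.coeff k))) :
    ∃ q' : K[X], (∀ k, SignType.sign (q'.coeff k) = SignType.sign (q.coeff k)) ∧
      ∀ k, SignType.sign (((X - C 1) * q').coeff k) = SignType.sign (p.coeff k) := by
  have hstep (k : ℕ) (β : K) (hβ : SignType.sign β = SignType.sign ((X * q).coeff k)) :
      ∃ γ : K, SignType.sign γ = SignType.sign (q.coeff k) ∧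
        SignType.sign (β - γ) = SignType.sign (p.coeff k) :=
    SignsBalance.exists_sign_eq_and_sign_sub_eq (by rw [hβ]; exact h k)
  choose! next hnextq hnextp using hstep
  let g : ℕ → K := fun k => k.rec (next 0 0) fun k γ => next (k + 1) γ
  have hgq (k : ℕ) : SignType.sign (g k) = SignType.sign (q.coeff k) := by
    induction k with
    | zero => exact hnextq 0 0 (by rw [coeff_X_mul_zero])
    | succ k ih => exact hnextq (k + 1) (g k) (by rw [coeff_X_mul, ih])
  have hcoeff (k : ℕ) : (∑ i ∈ q.support, monomial i (g i)).coeff k = g k := by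
    simp only [finsetSum_coeff, coeff_monomial, Finset.sum_ite_eq', mem_support_iff, ne_eq,
      ite_not, ite_eq_right_iff]
    intro hk
    rw [eq_comm, ← sign_eq_zero_iff, hgq, hk, sign_zero]
  refine ⟨∑ i ∈ q.support, monomial i (g i), fun k => by rw [hcoeff, hgq], fun k => ?_⟩
  rw [C_1, sub_mul, one_mul, coeff_sub, hcoeff]
  cases k with
  | zero => rw [coeff_X_mul_zero]; exact hnextp 0 0 (by rw [coeff_X_mul_zero])
  | succ k => rw [coeff_X_mul, hcoeff]; exact hnextp (k + 1) (g k) (by rw [coeff_X_mul, hgq])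

theorem succ_signVariations_le_of_signsBalance {p q : K[X]} (hq : q ≠ 0)
    (h : ∀ k, SignsBalance (SignType.sign (p.coeff k)) (-SignType.sign ((X * q).coeff k))
      (SignType.sign (q.coeff k))) :
    q.signVariations + 1 ≤ p.signVariations := by
  obtain ⟨q', hq', hp⟩ := exists_sign_coeff_eq_and_sign_coeff_X_sub_one_mul_eq h
  have hq'0 : q' ≠ 0 := by
    rintro rfl
    exact hq (ext fun k => sign_eq_zero_iff.1 ((hq' k).symm.trans sign_zero))
  rw [← signVariations_congr hq', ← signVariations_congr hp]
  exact succ_signVariations_le_X_sub_C_mul one_pos hq'0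

end Lift

/-! ### The Newton polygon of a tropical polynomial -/

namespace TMax

variable {Γ : Type*} [AddCommGroup Γ] [LinearOrder Γ] [IsOrderedAddMonoid Γ]

noncomputable instance : LinearOrderedCommGroupWithZero (TMax Γ) where
  __ := (inferInstance : CommSemiring (TMax Γ))
  __ := (inferInstance : LinearOrder (TMax Γ))
  bot := 0
  bot_le := zero_le
  isBot_zero := zero_le
  mul_lt_mul_of_pos_left a ha b c h := by
    simpa only [mul_comm a] using mul_lt_mul_right_of_ne ha.ne' h
  inv a := of (a.val.map Neg.neg)
  exists_pair_ne := ⟨0, 1, WithBot.bot_ne_coe⟩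
  inv_zero := rfl
  mul_inv_cancel a ha := by
    obtain ⟨g, rfl⟩ := WithBot.ne_bot_iff_exists.1 ha
    exact congrArg WithBot.some (add_neg_cancel g)

theorem add_eq_zero_iff {a b : TMax Γ} : a + b = 0 ↔ a = 0 ∧ b = 0 := by
  rw [add_eq_max, ← (zero_le a).ge_iff_eq', ← (zero_le b).ge_iff_eq',
    ← (zero_le (max a b)).ge_iff_eq', max_le_iff]

theorem sum_eq_sup {ι : Type*} (s : Finset ι) (f : ι → TMax Γ) : ∑ i ∈ s, f i = s.sup f := by
  classical
  induction s using Finset.induction_on with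
  | empty => rfl
  | insert i s hi ih => rw [Finset.sum_insert hi, Finset.sup_insert, ih]; rfl

theorem sum_eq_iff_exists {ι : Type*} {s : Finset ι} {f : ι → TMax Γ} {m : TMax Γ} (hm : m ≠ 0)
    (hf : ∀ i ∈ s, f i ≤ m) : ∑ i ∈ s, f i = m ↔ ∃ i ∈ s, f i = m := by
  rw [sum_eq_sup]
  refine ⟨fun h => ?_, fun ⟨i, hi, him⟩ => (Finset.sup_le hf).antisymm (him ▸ Finset.le_sup hi)⟩
  obtain rfl | hs := s.eq_empty_or_nonempty
  · exact absurd h.symm hm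
  · obtain ⟨i, hi, him⟩ := Finset.exists_mem_eq_sup s hs f
    exact ⟨i, hi, him.symm.trans h⟩

variable {p : (TMax Γ)[X]} {c d : TMax Γ}

theorem coeff_mul_pow_le_eval (p : (TMax Γ)[X]) (c : TMax Γ) (k : ℕ) :
    p.coeff k * c ^ k ≤ p.eval c := by
  obtain hk | hk := eq_or_ne (p.coeff k) 0
  · rw [hk, zero_mul]; exact zero_le _
  · rw [eval_eq_sum, sum_def, sum_eq_sup]
    exact Finset.le_sup (f := fun k => p.coeff k * c ^ k) (mem_support_iff.2 hk)

theorem eval_ne_zero (hp : p ≠ 0) (hc : c ≠ 0) : p.eval c ≠ 0 := by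
  have hlead := mul_ne_zero (leadingCoeff_ne_zero.2 hp) (pow_ne_zero p.natDegree hc)
  exact (((zero_le _).lt_of_ne' hlead).trans_le (coeff_mul_pow_le_eval p c _)).ne'

theorem mem_maxExponents (hp : p ≠ 0) (hc : c ≠ 0) {k : ℕ} :
    k ∈ maxExponents p c ↔ p.coeff k * c ^ k = p.eval c := by
  rw [maxExponents, Finset.mem_filter, mem_support_iff, and_iff_right_iff_imp]
  exact fun hk => left_ne_zero_of_mul (hk ▸ eval_ne_zero hp hc)

theorem maxExponents_nonempty (hp : p ≠ 0) (hc : c ≠ 0) : (maxExponents p c).Nonempty := by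
  have hsum : ∑ k ∈ p.support, p.coeff k * c ^ k = p.eval c := (eval_eq_sum ..).symm
  obtain ⟨k, -, hk⟩ := (sum_eq_iff_exists (eval_ne_zero hp hc)
    fun k _ => coeff_mul_pow_le_eval p c k).1 hsum
  exact ⟨k, (mem_maxExponents hp hc).2 hk⟩

theorem le_of_mem_maxExponents (hc : c ≠ 0) (hcd : c < d) {i j : ℕ} (hi : i ∈ maxExponents p c)
    (hj : j ∈ maxExponents p d) : i ≤ j := by
  by_contra! hji
  obtain ⟨e, rfl⟩ := Nat.exists_eq_add_of_lt hji
  simp only [maxExponents, Finset.mem_filter, mem_support_iff] at hi hj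
  have hd : 0 < d := (zero_le c).trans_lt hcd
  have hjc : p.coeff j * c ^ j ≤ p.coeff (j + e + 1) * c ^ (e + 1) * c ^ j := by
    rw [mul_assoc, ← pow_add, show e + 1 + j = j + e + 1 by ring, hi.2]
    exact coeff_mul_pow_le_eval p c j
  have hid : p.coeff (j + e + 1) * d ^ (e + 1) * d ^ j ≤ p.coeff j * d ^ j := by
    rw [mul_assoc, ← pow_add, show e + 1 + j = j + e + 1 by ring, hj.2]
    exact coeff_mul_pow_le_eval p d _
  have hle : p.coeff (j + e + 1) * d ^ (e + 1) ≤ p.coeff (j + e + 1) * c ^ (e + 1) :=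
    (le_of_mul_le_mul_right hid (pow_pos hd j)).trans
      (le_of_mul_le_mul_right hjc (pow_pos ((zero_le c).lt_of_ne' hc) j))
  exact hle.not_gt (mul_lt_mul_of_pos_left (pow_lt_pow_left₀ hcd (zero_le c) e.succ_ne_zero)
    ((zero_le _).lt_of_ne' hi.1))

open Classical in
/-- The exponents `k` whose edge `[k, k + 1]` of the Newton polygon of `p` corresponds to the
corner `c`, so that their number is the multiplicity of `c`. -/
noncomputable def cornerInterval (p : (TMax Γ)[X]) (c : TMax Γ) : Finset ℕ :=
  if c = 0 then Finset.range p.natTrailingDegree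
  else Finset.Ico (sInf (maxExponents p c : Set ℕ)) (sSup (maxExponents p c : Set ℕ))

theorem card_cornerInterval (p : (TMax Γ)[X]) (c : TMax Γ) :
    (cornerInterval p c).card = cornerMult p c := by
  rw [cornerInterval, cornerMult]
  split_ifs
  · exact Finset.card_range _
  · exact Nat.card_Ico _ _

theorem cornerInterval_subset_range (hp : p ≠ 0) (c : TMax Γ) :
    cornerInterval p c ⊆ Finset.range p.natDegree := by
  intro k hk
  rw [cornerInterval] at hk
  split_ifs at hk with hc
  · exact Finset.mem_range.2 ((Finset.mem_range.1 hk).trans_le p.natTrailingDegree_le_natDegree)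
  · have hmem := (maxExponents_nonempty hp hc).csSup_mem
    exact Finset.mem_range.2 ((Finset.mem_Ico.1 hk).2.trans_le
      (le_natDegree_of_mem_supp _ (Finset.mem_of_mem_filter _ hmem)))

theorem lt_of_mem_cornerInterval (hp : p ≠ 0) (hcd : c < d) {i j : ℕ}
    (hi : i ∈ cornerInterval p c) (hj : j ∈ cornerInterval p d) : i < j := by
  have hd : d ≠ 0 := ((zero_le c).trans_lt hcd).ne'
  have hdmem := (maxExponents_nonempty hp hd).csInf_mem
  rw [cornerInterval, if_neg hd, Finset.mem_Ico] at hj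
  refine lt_of_lt_of_le ?_ hj.1
  rw [cornerInterval] at hi
  split_ifs at hi with hc
  · exact (Finset.mem_range.1 hi).trans_le
      (natTrailingDegree_le_of_mem_supp _ (Finset.mem_of_mem_filter _ hdmem))
  · exact (Finset.mem_Ico.1 hi).2.trans_le
      (le_of_mem_maxExponents hc hcd (maxExponents_nonempty hp hc).csSup_mem hdmem)

theorem pairwise_disjoint_cornerInterval (hp : p ≠ 0) :
    Pairwise (Function.onFun Disjoint (cornerInterval p)) := by
  intro c d hcd
  refine Finset.disjoint_left.2 fun k hkc hkd => ?_
  obtain hlt | hlt := hcd.lt_or_gt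
  · exact (lt_of_mem_cornerInterval hp hlt hkc hkd).false
  · exact (lt_of_mem_cornerInterval hp hlt hkd hkc).false

theorem sum_cornerMult_le_natDegree (hp : p ≠ 0) (s : Finset (TMax Γ)) :
    ∑ c ∈ s, cornerMult p c ≤ p.natDegree := by
  simp only [← card_cornerInterval]
  rw [← Finset.card_biUnion fun c _ d _ hcd => pairwise_disjoint_cornerInterval hp hcd]
  exact (Finset.card_le_card (Finset.biUnion_subset.2 fun c _ =>
    cornerInterval_subset_range hp c)).trans_eq (Finset.card_range _)

theorem isCorner_of_cornerMult_pos (h : 0 < cornerMult p c) : IsCorner p c := by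
  rw [cornerMult] at h
  rw [IsCorner]
  split_ifs at h ⊢ with hc
  · exact coeff_eq_zero_of_lt_natTrailingDegree h
  · have hlt := Nat.sub_pos_iff_lt.1 h
    have hne : (maxExponents p c).Nonempty := by
      rw [Finset.nonempty_iff_ne_empty]
      intro he
      simp [he] at hlt
    exact Finset.one_lt_card.2 ⟨_, hne.csInf_mem, _, hne.csSup_mem, hlt.ne⟩

end TMax

/-! ### Signs in the symmetrized tropical semiring -/

namespace TPair

variable {Γ : Type*} [LinearOrder Γ]

/-- The sign of the formal difference of the components of a pair; it is zero when they are
equal. -/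
noncomputable def sign (a : TPair Γ) : SignType :=
  if a.snd < a.fst then 1 else if a.fst < a.snd then -1 else 0

theorem sign_eq_one_iff (a : TPair Γ) : a.sign = 1 ↔ a.snd < a.fst := by
  simp only [sign]
  split_ifs with h <;> simp [h]

theorem sign_eq_zero_iff (a : TPair Γ) : a.sign = 0 ↔ a.fst = a.snd := by
  simp only [sign]
  split_ifs with h h'
  · simp [h.ne']
  · simp [h'.ne]
  · simpa using (not_lt.1 h).antisymm (not_lt.1 h')

theorem sign_neg (a : TPair Γ) : a.neg.sign = -a.sign := by
  simp only [sign, neg]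
  obtain h | h | h := lt_trichotomy a.fst a.snd <;> simp [h, h.not_gt]

variable [AddCommGroup Γ] [IsOrderedAddMonoid Γ]

theorem Rel.sign {a b : TPair Γ} (h : Rel a b) : a.sign = b.sign := by
  simp only [rel_iff, TPair.ext_iff, TPair.sign] at h ⊢
  grind

theorem neg_mul (a b : TPair Γ) : a.neg * b = (a * b).neg := by
  ext <;> simp only [neg, mul_fst, mul_snd, add_comm]

theorem snd_mul_lt_fst_mul {a b : TPair Γ} (ha : a.snd < a.fst) (hb : b.snd < b.fst) :
    (a * b).snd < (a * b).fst := by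
  have ha' : 0 < a.fst := (TMax.zero_le _).trans_lt ha
  have hb' : 0 < b.fst := (TMax.zero_le _).trans_lt hb
  rw [mul_fst, mul_snd, TMax.add_eq_max, TMax.add_eq_max]
  exact lt_max_of_lt_left
    (max_lt (mul_lt_mul_of_pos_left hb ha') (TMax.mul_lt_mul_right_of_ne hb'.ne' ha))

theorem sign_mul (a b : TPair Γ) : (a * b).sign = a.sign * b.sign := by
  wlog ha : a.snd ≤ a.fst generalizing a b with H
  · rw [← neg_inj, ← sign_neg, ← neg_mul, H _ b (le_of_not_ge ha), sign_neg, _root_.neg_mul]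
  wlog hb : b.snd ≤ b.fst generalizing b with H
  · rw [← neg_inj, ← sign_neg, mul_comm, ← neg_mul, mul_comm, H _ (le_of_not_ge hb), sign_neg,
      mul_neg]
  obtain ha | ha := ha.eq_or_lt
  · rw [(sign_eq_zero_iff a).2 ha.symm, zero_mul, sign_eq_zero_iff, mul_fst, mul_snd, ha, add_comm]
  obtain hb | hb := hb.eq_or_lt
  · rw [(sign_eq_zero_iff b).2 hb.symm, mul_zero, sign_eq_zero_iff, mul_fst, mul_snd, hb]
  rw [(sign_eq_one_iff a).2 ha, (sign_eq_one_iff b).2 hb, mul_one, sign_eq_one_iff]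
  exact snd_mul_lt_fst_mul ha hb

theorem fst_sum {ι : Type*} (s : Finset ι) (f : ι → TPair Γ) :
    (∑ i ∈ s, f i).fst = ∑ i ∈ s, (f i).fst :=
  map_sum (⟨⟨fst, zero_fst⟩, add_fst⟩ : TPair Γ →+ TMax Γ) f s

theorem snd_sum {ι : Type*} (s : Finset ι) (f : ι → TPair Γ) :
    (∑ i ∈ s, f i).snd = ∑ i ∈ s, (f i).snd :=
  map_sum (⟨⟨snd, zero_snd⟩, add_snd⟩ : TPair Γ →+ TMax Γ) f s

end TPair

namespace SMax

variable {Γ : Type*} [AddCommGroup Γ] [LinearOrder Γ] [IsOrderedAddMonoid Γ]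

theorem mk_surjective : Function.Surjective (mk : TPair Γ → SMax Γ) :=
  RingCon.mk'_surjective (TPair.con Γ)

/-- The sign of the difference of the components of a representative; on signed elements it is the
sign, and it vanishes on balanced elements. -/
noncomputable def sign : SMax Γ →*₀ SignType where
  toFun := Quotient.lift TPair.sign fun _ _ h => h.sign
  map_zero' := by
    change TPair.sign (0 : TPair Γ) = 0
    simp [TPair.sign]
  map_one' := by
    change TPair.sign (1 : TPair Γ) = 1
    simp [TPair.sign]
  map_mul' a b := by
    induction a, b using Quotient.inductionOn₂ with
    | h a b => exact TPair.sign_mul a b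

variable {a b : SMax Γ}

theorem abs_mk (x : TPair Γ) : abs (mk x) = x.fst + x.snd := rfl

theorem sign_mk (x : TPair Γ) : sign (mk x) = x.sign := rfl

theorem sign_neg (a : SMax Γ) : sign (neg a) = -sign a := by
  obtain ⟨x, rfl⟩ := mk_surjective a
  exact x.sign_neg

theorem abs_neg (a : SMax Γ) : abs (neg a) = abs a := by
  obtain ⟨x, rfl⟩ := mk_surjective a
  exact add_comm _ _

theorem neg_neg (a : SMax Γ) : neg (neg a) = a := by
  obtain ⟨x, rfl⟩ := mk_surjective a
  rfl

theorem neg_zero : neg (0 : SMax Γ) = 0 := rfl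

theorem neg_add (a b : SMax Γ) : neg (a + b) = neg a + neg b := by
  obtain ⟨x, rfl⟩ := mk_surjective a
  obtain ⟨y, rfl⟩ := mk_surjective b
  rfl

theorem neg_mul (a b : SMax Γ) : neg a * b = neg (a * b) := by
  obtain ⟨x, rfl⟩ := mk_surjective a
  obtain ⟨y, rfl⟩ := mk_surjective b
  exact congrArg mk (x.neg_mul y)

theorem abs_eq_zero : abs a = 0 ↔ a = 0 := by
  refine ⟨fun h => ?_, fun h => h ▸ map_zero abs⟩
  obtain ⟨x, rfl⟩ := mk_surjective a
  obtain ⟨hfst, hsnd⟩ := TMax.add_eq_zero_iff.1 h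
  exact congrArg mk (TPair.ext hfst hsnd)

theorem balances_iff_balances_add_neg_zero : Balances a b ↔ Balances (a + neg b) 0 := by
  obtain ⟨x, rfl⟩ := mk_surjective a
  obtain ⟨y, rfl⟩ := mk_surjective b
  change x.fst + y.snd = x.snd + y.fst ↔ x.fst + y.snd + 0 = x.snd + y.fst + 0
  rw [add_zero, add_zero]

theorem Balances.mul_right (h : Balances a b) (c : SMax Γ) : Balances (a * c) (b * c) := by
  obtain ⟨x, rfl⟩ := mk_surjective a
  obtain ⟨y, rfl⟩ := mk_surjective b
  obtain ⟨z, rfl⟩ := mk_surjective c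
  change x.fst + y.snd = x.snd + y.fst at h
  change x.fst * z.fst + x.snd * z.snd + (y.fst * z.snd + y.snd * z.fst) =
    x.fst * z.snd + x.snd * z.fst + (y.fst * z.fst + y.snd * z.snd)
  calc _ = (x.fst + y.snd) * z.fst + (x.snd + y.fst) * z.snd := by ring
    _ = (x.snd + y.fst) * z.fst + (x.fst + y.snd) * z.snd := by rw [h]
    _ = _ := by ring

instance : NoZeroDivisors (SMax Γ) where
  eq_zero_or_eq_zero_of_mul_eq_zero {a b} h := by
    rwa [← abs_eq_zero, map_mul, mul_eq_zero, abs_eq_zero, abs_eq_zero] at h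

theorem isSigned_zero : IsSigned (0 : SMax Γ) := ⟨0, Or.inl rfl⟩

theorem isSigned_one : IsSigned (1 : SMax Γ) := ⟨1, Or.inl rfl⟩

theorem IsSigned.neg (ha : IsSigned a) : IsSigned (neg a) := by
  obtain ⟨c, rfl | rfl⟩ := ha
  exacts [⟨c, Or.inr rfl⟩, ⟨c, Or.inl rfl⟩]

theorem IsSigned.mul (ha : IsSigned a) (hb : IsSigned b) : IsSigned (a * b) := by
  obtain ⟨c, rfl | rfl⟩ := ha <;> obtain ⟨d, rfl | rfl⟩ := hb <;> rw [← map_mul]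
  · exact ⟨c * d, Or.inl (congrArg mk (by ext <;> simp))⟩
  · exact ⟨c * d, Or.inr (congrArg mk (by ext <;> simp))⟩
  · exact ⟨c * d, Or.inr (congrArg mk (by ext <;> simp))⟩
  · exact ⟨c * d, Or.inl (congrArg mk (by ext <;> simp))⟩

theorem IsSigned.pow (ha : IsSigned a) (k : ℕ) : IsSigned (a ^ k) := by
  induction k with
  | zero => exact pow_zero a ▸ isSigned_one
  | succ k ih => exact pow_succ a k ▸ ih.mul ha

theorem IsSigned.sign_eq_zero_iff (ha : IsSigned a) : sign a = 0 ↔ a = 0 := by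
  refine ⟨fun h => ?_, fun h => h ▸ map_zero sign⟩
  obtain ⟨c, rfl | rfl⟩ := ha <;> rw [sign_mk, TPair.sign_eq_zero_iff] at h <;> dsimp only at h
  · rw [h]; rfl
  · rw [← h]; rfl

theorem IsSigned.ne_neg (ha : IsSigned a) (ha0 : a ≠ 0) : a ≠ SMax.neg a := by
  intro h
  have hsign := congrArg sign h
  rw [sign_neg, SignType.self_eq_neg_iff, ha.sign_eq_zero_iff] at hsign
  exact ha0 hsign

theorem IsSigned.eq_or_eq_neg (ha : IsSigned a) (hb : IsSigned b) (h : abs a = abs b) :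
    a = b ∨ a = SMax.neg b := by
  obtain ⟨c, rfl | rfl⟩ := ha <;> obtain ⟨d, rfl | rfl⟩ := hb <;>
    simp only [abs_mk, add_zero, zero_add] at h <;> subst h
  exacts [Or.inl rfl, Or.inr rfl, Or.inr rfl, Or.inl rfl]

theorem IsSigned.eq_of_balances (ha : IsSigned a) (hb : IsSigned b) (h : Balances a b) :
    a = b := by
  obtain ⟨c, rfl | rfl⟩ := ha <;> obtain ⟨d, rfl | rfl⟩ := hb
  · change c + 0 = 0 + d at h
    rw [add_zero, zero_add] at h
    rw [h]
  · change c + d = 0 + 0 at h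
    rw [add_zero, TMax.add_eq_zero_iff] at h
    rw [h.1, h.2]
  · change 0 + 0 = c + d at h
    rw [add_zero, eq_comm, TMax.add_eq_zero_iff] at h
    rw [h.1, h.2]
  · change 0 + d = c + 0 at h
    rw [add_zero, zero_add] at h
    rw [h]

/-- The sign of `a` as seen among terms of absolute value at most `m`: it is zero when `a` is
dominated by `m`. -/
noncomputable def signAt (m : TMax Γ) (a : SMax Γ) : SignType :=
  if abs a = m then sign a else 0

variable {m : TMax Γ} {c : SMax Γ}

theorem signAt_zero (m : TMax Γ) : signAt m 0 = 0 := by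
  rw [signAt, map_zero sign, ite_self]

theorem signAt_neg (m : TMax Γ) (a : SMax Γ) : signAt m (neg a) = -signAt m a := by
  rw [signAt, signAt, abs_neg, sign_neg, neg_ite, _root_.neg_zero]

theorem signAt_abs_mul (ha : a ≠ 0) (m : TMax Γ) (b : SMax Γ) :
    signAt (abs a * m) (a * b) = sign a * signAt m b := by
  simp only [signAt, map_mul, mul_right_inj' (abs_eq_zero.not.2 ha), mul_ite, mul_zero]

theorem IsSigned.signAt_ne_zero_iff (ha : IsSigned a) (hm : m ≠ 0) :
    signAt m a ≠ 0 ↔ abs a = m := by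
  rw [signAt, ite_ne_right_iff, and_iff_left_iff_imp]
  exact fun h => ha.sign_eq_zero_iff.not.2 (abs_eq_zero.not.1 (h ▸ hm))

theorem IsSigned.exists_mk_eq (ha : IsSigned a) :
    ∃ x : TPair Γ, mk x = a ∧ (x.fst = 0 ∨ x.snd = 0) := by
  obtain ⟨c, rfl | rfl⟩ := ha
  exacts [⟨_, rfl, Or.inr rfl⟩, ⟨_, rfl, Or.inl rfl⟩]

theorem signAt_mk_eq_one_iff {x : TPair Γ} (hx : x.fst = 0 ∨ x.snd = 0) (hm : m ≠ 0) :
    signAt m (mk x) = 1 ↔ x.fst = m := by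
  refine ⟨fun h => ?_, fun h => ?_⟩
  · obtain ⟨habs, hsign⟩ : abs (mk x) = m ∧ sign (mk x) = 1 := by
      rw [signAt] at h
      split_ifs at h with habs
      exact ⟨habs, h⟩
    rw [← habs, abs_mk, TMax.add_eq_max, max_eq_left ((x.sign_eq_one_iff).1 hsign).le]
  · have hsnd : x.snd = 0 := hx.resolve_left (h ▸ hm)
    rw [signAt, if_pos (by rw [abs_mk, hsnd, add_zero, h]), sign_mk, x.sign_eq_one_iff, hsnd, h]
    exact (TMax.zero_le m).lt_of_ne' hm

theorem signAt_mk_eq_neg_one_iff {x : TPair Γ} (hx : x.fst = 0 ∨ x.snd = 0) (hm : m ≠ 0) :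
    signAt m (mk x) = -1 ↔ x.snd = m := by
  rw [← neg_inj, ← signAt_neg, _root_.neg_neg]
  exact signAt_mk_eq_one_iff hx.symm hm

theorem exists_signAt_eq_one_iff_of_balances_zero {ι : Type*} {s : Finset ι} {f : ι → SMax Γ}
    (hf : ∀ i, IsSigned (f i)) (hm : m ≠ 0) (hle : ∀ i ∈ s, abs (f i) ≤ m)
    (h : Balances (∑ i ∈ s, f i) 0) :
    (∃ i ∈ s, signAt m (f i) = 1) ↔ ∃ i ∈ s, signAt m (f i) = -1 := by
  choose x hxf hx using fun i => (hf i).exists_mk_eq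
  obtain rfl : (fun i => mk (x i)) = f := funext hxf
  have hfst : ∑ i ∈ s, (x i).fst = m ↔ ∃ i ∈ s, (x i).fst = m :=
    TMax.sum_eq_iff_exists hm fun i hi => (le_max_left _ _).trans (hle i hi)
  have hsnd : ∑ i ∈ s, (x i).snd = m ↔ ∃ i ∈ s, (x i).snd = m :=
    TMax.sum_eq_iff_exists hm fun i hi => (le_max_right _ _).trans (hle i hi)
  have hsum : ∑ i ∈ s, (x i).fst = ∑ i ∈ s, (x i).snd := by
    rw [← map_sum] at h
    change (∑ i ∈ s, x i).fst + 0 = (∑ i ∈ s, x i).snd + 0 at h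
    rwa [add_zero, add_zero, TPair.fst_sum, TPair.snd_sum] at h
  simp only [signAt_mk_eq_one_iff (hx _) hm, signAt_mk_eq_neg_one_iff (hx _) hm]
  rw [← hfst, ← hsnd, hsum]

theorem signsBalance_signAt_of_balances (ha : IsSigned a) (hb : IsSigned b) (hc : IsSigned c)
    (hm : m ≠ 0) (ham : abs a ≤ m) (hbm : abs b ≤ m) (hcm : abs c ≤ m)
    (h : Balances a (b + neg c)) :
    SignsBalance (signAt m a) (-signAt m b) (signAt m c) := by
  have hsum : Balances (∑ i, ![a, neg b, c] i) 0 := by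
    rw [balances_iff_balances_add_neg_zero, neg_add, neg_neg, ← add_assoc] at h
    rwa [Fin.sum_univ_three]
  have hsigned : ∀ i, IsSigned (![a, neg b, c] i) := by
    simp [Fin.forall_fin_succ, ha, hb.neg, hc]
  have hle : ∀ i ∈ Finset.univ, abs (![a, neg b, c] i) ≤ m := by
    simp [Fin.forall_fin_succ, ham, abs_neg, hbm, hcm]
  simpa [SignsBalance, Fin.exists_fin_succ, signAt_neg] using
    exists_signAt_eq_one_iff_of_balances_zero hsigned hm hle hsum

end SMax

/-! ### Dominant signs of a polynomial -/

namespace SMax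

variable {Γ : Type*} [AddCommGroup Γ] [LinearOrder Γ] [IsOrderedAddMonoid Γ]

theorem support_map_abs (P : (SMax Γ)[X]) : (P.map abs).support = P.support := by
  ext k
  rw [mem_support_iff, mem_support_iff, coeff_map, Ne, abs_eq_zero]

theorem map_abs_ne_zero {P : (SMax Γ)[X]} (hP : P ≠ 0) : P.map abs ≠ 0 := by
  rwa [Ne, ← support_eq_empty, support_map_abs, support_eq_empty]

/-- The largest absolute value of a coefficient, encoded as a value at `1`: sums in `TMax Γ` are
maxima. -/
noncomputable def height (P : (SMax Γ)[X]) : TMax Γ := (P.map abs).eval 1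

/-- The signs of the coefficients of absolute value `m`, as a polynomial with coefficients in
`{-1, 0, 1}`, which is meant for polynomials of height at most `m`. -/
noncomputable def signPoly (m : TMax Γ) (P : (SMax Γ)[X]) : ℚ[X] :=
  ∑ k ∈ P.support, monomial k (signAt m (P.coeff k) : ℚ)

/-- The signs of the coefficients of largest absolute value; the other coefficients are replaced by
zero. -/
noncomputable def dominantSigns (P : (SMax Γ)[X]) : ℚ[X] := signPoly (height P) P

variable {m : TMax Γ} {P Q : (SMax Γ)[X]} {r s : SMax Γ}

theorem abs_coeff_le_height (P : (SMax Γ)[X]) (k : ℕ) : abs (P.coeff k) ≤ height P := by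
  simpa only [height, coeff_map, one_pow, mul_one] using
    TMax.coeff_mul_pow_le_eval (P.map abs) 1 k

theorem height_ne_zero (hP : P ≠ 0) : height P ≠ 0 :=
  TMax.eval_ne_zero (map_abs_ne_zero hP) one_ne_zero

theorem exists_abs_coeff_eq_height (hP : P ≠ 0) : ∃ k, abs (P.coeff k) = height P := by
  obtain ⟨k, hk⟩ := TMax.maxExponents_nonempty (map_abs_ne_zero hP) one_ne_zero
  rw [TMax.mem_maxExponents (map_abs_ne_zero hP) one_ne_zero] at hk
  exact ⟨k, by simpa only [height, coeff_map, one_pow, mul_one] using hk⟩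

theorem height_C_mul (s : SMax Γ) (P : (SMax Γ)[X]) : height (C s * P) = abs s * height P := by
  simp [height]

theorem height_X_mul (P : (SMax Γ)[X]) : height (X * P) = height P := by
  simp [height]

theorem height_comp_C_mul_X (r : SMax Γ) (P : (SMax Γ)[X]) :
    height (P.comp (C r * X)) = (P.map abs).eval (abs r) := by
  simp [height, Polynomial.map_comp]

theorem coeff_signPoly (m : TMax Γ) (P : (SMax Γ)[X]) (k : ℕ) :
    (signPoly m P).coeff k = (signAt m (P.coeff k) : ℚ) := by
  simp only [signPoly, finsetSum_coeff, coeff_monomial, Finset.sum_ite_eq', ite_eq_left_iff]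
  intro hk
  rw [notMem_support_iff.1 hk, signAt_zero, SignType.coe_zero]

theorem sign_coeff_signPoly (m : TMax Γ) (P : (SMax Γ)[X]) (k : ℕ) :
    SignType.sign ((signPoly m P).coeff k) = signAt m (P.coeff k) := by
  rw [coeff_signPoly]
  cases signAt m (P.coeff k) <;> simp

theorem signPoly_X_mul (m : TMax Γ) (P : (SMax Γ)[X]) : signPoly m (X * P) = X * signPoly m P := by
  ext (_ | k)
  · rw [coeff_signPoly, coeff_X_mul_zero, coeff_X_mul_zero, signAt_zero, SignType.coe_zero]
  · rw [coeff_signPoly, coeff_X_mul, coeff_X_mul, coeff_signPoly]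

theorem IsSignedPoly.X_mul (hP : IsSignedPoly P) : IsSignedPoly (X * P) := by
  rintro (_ | k)
  · rw [coeff_X_mul_zero]; exact isSigned_zero
  · rw [coeff_X_mul]; exact hP k

theorem IsSignedPoly.C_mul (hP : IsSignedPoly P) (hs : IsSigned s) : IsSignedPoly (C s * P) := by
  intro k
  rw [coeff_C_mul]
  exact hs.mul (hP k)

theorem IsSignedPoly.comp_C_mul_X (hP : IsSignedPoly P) (hr : IsSigned r) :
    IsSignedPoly (P.comp (C r * X)) := by
  intro k
  rw [comp_C_mul_X_coeff]
  exact (hP k).mul (hr.pow k)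

theorem IsSignedPoly.signPoly_ne_zero_iff (hP : IsSignedPoly P) (hm : m ≠ 0)
    (hle : height P ≤ m) : signPoly m P ≠ 0 ↔ height P = m := by
  have hcoeff : signPoly m P ≠ 0 ↔ ∃ k, abs (P.coeff k) = m := by
    rw [Ne, Polynomial.ext_iff, not_forall]
    refine exists_congr fun k => ?_
    rw [coeff_zero, ← sign_eq_zero_iff, sign_coeff_signPoly, ← Ne,
      (hP k).signAt_ne_zero_iff hm]
  rw [hcoeff]
  refine ⟨fun ⟨k, hk⟩ => hle.antisymm (hk ▸ abs_coeff_le_height P k), ?_⟩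
  rintro rfl
  exact exists_abs_coeff_eq_height (by rintro rfl; simp [height] at hm)

theorem signsBalance_coeff_signPoly (hP : IsSignedPoly P) (hQ : IsSignedPoly Q) (hm : m ≠ 0)
    (hPm : height P ≤ m) (hQm : height Q ≤ m)
    (h : ∀ k, Balances (P.coeff k) (((X + C (neg 1)) * Q).coeff k)) (k : ℕ) :
    SignsBalance (SignType.sign ((signPoly m P).coeff k))
      (-SignType.sign ((X * signPoly m Q).coeff k)) (SignType.sign ((signPoly m Q).coeff k)) := by
  rw [← signPoly_X_mul, sign_coeff_signPoly, sign_coeff_signPoly, sign_coeff_signPoly]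
  refine signsBalance_signAt_of_balances (hP k) (hQ.X_mul k) (hQ k) hm
    ((abs_coeff_le_height P k).trans hPm) ((abs_coeff_le_height _ k).trans ?_)
    ((abs_coeff_le_height Q k).trans hQm) ?_
  · rwa [height_X_mul]
  · have hk := h k
    rwa [add_mul, coeff_add, coeff_C_mul, neg_mul, one_mul] at hk

theorem succ_signVariations_dominantSigns_le (hP : IsSignedPoly P) (hQ : IsSignedPoly Q)
    (hP0 : P ≠ 0) (h : ∀ k, Balances (P.coeff k) (((X + C (neg 1)) * Q).coeff k)) :
    (dominantSigns Q).signVariations + 1 ≤ (dominantSigns P).signVariations := by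
  obtain ⟨m, hm⟩ : ∃ m, m = max (height P) (height Q) := ⟨_, rfl⟩
  have hPm : height P ≤ m := hm ▸ le_max_left _ _
  have hQm : height Q ≤ m := hm ▸ le_max_right _ _
  have hm0 : m ≠ 0 := fun h0 => height_ne_zero hP0 ((h0 ▸ hPm).antisymm (TMax.zero_le _))
  have hbal := signsBalance_coeff_signPoly hP hQ hm0 hPm hQm h
  have hQne : signPoly m Q ≠ 0 := by
    intro hQ0
    have hP0' : signPoly m P = 0 := by
      ext k
      have hk : SignsBalance (SignType.sign ((signPoly m P).coeff k)) (-0) 0 := by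
        simpa only [hQ0, mul_zero, coeff_zero, sign_zero] using hbal k
      rw [coeff_zero, ← sign_eq_zero_iff]
      exact hk.eq_zero
    obtain hm' | hm' := max_choice (height P) (height Q)
    · exact (hP.signPoly_ne_zero_iff hm0 hPm).2 (hm'.symm.trans hm.symm) hP0'
    · exact (hQ.signPoly_ne_zero_iff hm0 hQm).2 (hm'.symm.trans hm.symm) hQ0
  have hlt := succ_signVariations_le_of_signsBalance hQne hbal
  have hPne : signPoly m P ≠ 0 := by
    rintro hP0'
    rw [hP0', signVariations_zero] at hlt
    exact absurd hlt (by simp)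
  rw [dominantSigns, dominantSigns, (hP.signPoly_ne_zero_iff hm0 hPm).1 hPne,
    (hQ.signPoly_ne_zero_iff hm0 hQm).1 hQne]
  exact hlt

theorem dominantSigns_C_mul (hs : s ≠ 0) (P : (SMax Γ)[X]) :
    dominantSigns (C s * P) = C (sign s : ℚ) * dominantSigns P := by
  ext k
  rw [dominantSigns, dominantSigns, coeff_C_mul, coeff_signPoly, coeff_signPoly, height_C_mul,
    coeff_C_mul, signAt_abs_mul hs, SignType.coe_mul]

theorem IsSigned.signVariations_dominantSigns_C_mul (hs : IsSigned s) (hs0 : s ≠ 0)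
    (P : (SMax Γ)[X]) :
    (dominantSigns (C s * P)).signVariations = (dominantSigns P).signVariations := by
  have hsign : (sign s : ℚ) ≠ 0 := by
    have hne : sign s ≠ 0 := hs.sign_eq_zero_iff.not.2 hs0
    revert hne
    cases sign s <;> simp
  rw [dominantSigns_C_mul hs0, signVariations_C_mul _ hsign]

theorem dominantSigns_comp_neg (r : SMax Γ) (P : (SMax Γ)[X]) :
    dominantSigns (P.comp (C (neg r) * X)) = (dominantSigns (P.comp (C r * X))).comp (-X) := by
  ext k
  simp only [dominantSigns, height_comp_C_mul_X, abs_neg, coeff_comp_neg_X, coeff_signPoly,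
    comp_C_mul_X_coeff, signAt, map_mul, map_pow, sign_neg]
  rw [neg_pow, mul_left_comm, ← mul_ite_zero, SignType.coe_mul, SignType.coe_pow]
  simp [mul_comm]

theorem IsSigned.support_dominantSigns_comp (hr : IsSigned r) (hr0 : r ≠ 0)
    (hP : IsSignedPoly P) (hP0 : P ≠ 0) :
    (dominantSigns (P.comp (C r * X))).support =
      TMax.maxExponents (P.map abs) (abs r) := by
  ext k
  rw [TMax.mem_maxExponents (map_abs_ne_zero hP0) (abs_eq_zero.not.2 hr0), mem_support_iff,
    dominantSigns, ← sign_ne_zero, sign_coeff_signPoly, height_comp_C_mul_X, comp_C_mul_X_coeff,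
    ((hP k).mul (hr.pow k)).signAt_ne_zero_iff (TMax.eval_ne_zero (map_abs_ne_zero hP0)
      (abs_eq_zero.not.2 hr0)), map_mul, map_pow, coeff_map]

end SMax

/-! ### Multiplicities of roots -/

namespace SMax

variable {Γ : Type*} [AddCommGroup Γ] [LinearOrder Γ] [IsOrderedAddMonoid Γ]
variable {P Q : (SMax Γ)[X]} {r : SMax Γ}

/-- The number of sign changes in the sequence of dominant terms of `P` at `r`, which bounds the
multiplicity of `r` as in Descartes' rule of signs. -/
noncomputable def variation (r : SMax Γ) (P : (SMax Γ)[X]) : ℕ :=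
  (dominantSigns (P.comp (C r * X))).signVariations

theorem IsSigned.comp_C_mul_X_ne_zero (hr : IsSigned r) (hr0 : r ≠ 0) (hP : IsSignedPoly P)
    (hP0 : P ≠ 0) : P.comp (C r * X) ≠ 0 := by
  obtain ⟨k, hk⟩ := TMax.maxExponents_nonempty (map_abs_ne_zero hP0) (abs_eq_zero.not.2 hr0)
  rw [← hr.support_dominantSigns_comp hr0 hP hP0] at hk
  intro h
  simp [h, dominantSigns, signPoly] at hk

theorem IsQuotient.ne_zero (h : IsQuotient r P Q) (hP : IsSignedPoly P) (hP0 : P ≠ 0) :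
    Q ≠ 0 := by
  rintro rfl
  obtain ⟨-, lam, hlam, hlam0, hbal⟩ := h
  refine hP0 (Polynomial.ext fun k => ?_)
  have hk := hbal k
  rw [mul_zero, coeff_zero] at hk
  have hk0 := (hP.C_mul hlam k).eq_of_balances isSigned_zero hk
  rw [coeff_C_mul] at hk0
  exact (mul_eq_zero.1 hk0).resolve_left hlam0

theorem X_add_neg_one_mul_comp (r : SMax Γ) (Q : (SMax Γ)[X]) :
    (X + C (neg 1)) * (C r * Q.comp (C r * X)) = ((X + C (neg r)) * Q).comp (C r * X) := by
  have hneg : C (neg r) = C (neg 1) * C r := by rw [← C_mul, neg_mul, one_mul]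
  rw [mul_comp, add_comp, X_comp, C_comp, hneg]
  ring

theorem IsQuotient.succ_variation_le (h : IsQuotient r P Q) (hr : IsSigned r) (hr0 : r ≠ 0)
    (hP : IsSignedPoly P) (hP0 : P ≠ 0) : variation r Q + 1 ≤ variation r P := by
  obtain ⟨hQ, lam, hlam, hlam0, hbal⟩ := h
  rw [variation, variation, ← hlam.signVariations_dominantSigns_C_mul hlam0 (P.comp _),
    ← hr.signVariations_dominantSigns_C_mul hr0]
  refine succ_signVariations_dominantSigns_le ((hP.comp_C_mul_X hr).C_mul hlam)
    ((hQ.comp_C_mul_X hr).C_mul hr)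
    (mul_ne_zero (C_ne_zero.2 hlam0) (hr.comp_C_mul_X_ne_zero hr0 hP hP0)) fun k => ?_
  have hk := (hbal k).mul_right (r ^ k)
  rwa [← comp_C_mul_X_coeff, ← comp_C_mul_X_coeff, ← X_add_neg_one_mul_comp, mul_comp, C_comp]
    at hk

theorem signVariations_dominantSigns_pos (hP : IsSignedPoly P) (hP0 : P ≠ 0)
    (h : Balances (P.eval 1) 0) : 0 < (dominantSigns P).signVariations := by
  have hm := height_ne_zero hP0
  have hbal : Balances (∑ k ∈ P.support, P.coeff k) 0 := by
    simpa only [eval_eq_sum, sum_def, one_pow, mul_one] using h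
  have hiff := exists_signAt_eq_one_iff_of_balances_zero hP hm
    (fun k _ => abs_coeff_le_height P k) hbal
  obtain ⟨k, hk⟩ := exists_abs_coeff_eq_height hP0
  have hksupp : k ∈ P.support := mem_support_iff.2 (abs_eq_zero.not.1 (hk ▸ hm))
  have hk0 : signAt (height P) (P.coeff k) ≠ 0 := ((hP k).signAt_ne_zero_iff hm).2 hk
  obtain ⟨⟨i, -, hi⟩, ⟨j, -, hj⟩⟩ : (∃ i ∈ P.support, signAt (height P) (P.coeff i) = 1) ∧
      ∃ j ∈ P.support, signAt (height P) (P.coeff j) = -1 := by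
    obtain hneg | hzero | hpos := (signAt (height P) (P.coeff k)).trichotomy
    · exact ⟨hiff.2 ⟨k, hksupp, hneg⟩, ⟨k, hksupp, hneg⟩⟩
    · exact absurd hzero hk0
    · exact ⟨⟨k, hksupp, hpos⟩, hiff.1 ⟨k, hksupp, hpos⟩⟩
  rw [← sign_coeff_signPoly] at hi hj
  exact signVariations_pos (sign_eq_one_iff.1 hi) (sign_eq_neg_one_iff.1 hj)

theorem IsSignedRoot.variation_pos (h : IsSignedRoot P r) (hr0 : r ≠ 0) (hP : IsSignedPoly P)
    (hP0 : P ≠ 0) : 0 < variation r P := by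
  refine signVariations_dominantSigns_pos (hP.comp_C_mul_X h.1)
    (h.1.comp_C_mul_X_ne_zero hr0 hP hP0) ?_
  rw [eval_comp, eval_C_mul, eval_X, mul_one]
  exact h.2

theorem IsSigned.cornerMult_map_abs (hr : IsSigned r) (hr0 : r ≠ 0) (hP : IsSignedPoly P)
    (hP0 : P ≠ 0) :
    TMax.cornerMult (P.map abs) (abs r) = (dominantSigns (P.comp (C r * X))).natDegree -
      (dominantSigns (P.comp (C r * X))).natTrailingDegree := by
  have hsupp := hr.support_dominantSigns_comp hr0 hP hP0
  have hne := TMax.maxExponents_nonempty (map_abs_ne_zero hP0) (abs_eq_zero.not.2 hr0)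
  have h0 : dominantSigns (P.comp (C r * X)) ≠ 0 := by
    rwa [← support_nonempty, hsupp]
  rw [TMax.cornerMult, if_neg (abs_eq_zero.not.2 hr0), natDegree_eq_support_max' h0,
    natTrailingDegree_eq_support_min' h0, hne.csSup_eq_max', hne.csInf_eq_min']
  simp only [hsupp]

theorem IsSigned.variation_add_variation_neg_le (hr : IsSigned r) (hr0 : r ≠ 0)
    (hP : IsSignedPoly P) (hP0 : P ≠ 0) :
    variation r P + variation (SMax.neg r) P ≤ TMax.cornerMult (P.map abs) (abs r) := by
  rw [variation, variation, dominantSigns_comp_neg, hr.cornerMult_map_abs hr0 hP hP0]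
  exact signVariations_add_signVariations_comp_neg_X_le _

theorem rootMult_le_of_isQuotient {f : (SMax Γ)[X] → ℕ}
    (hroot : ∀ P, IsSignedPoly P → P ≠ 0 → IsSignedRoot P r → 0 < f P)
    (hquot : ∀ P Q, IsSignedPoly P → P ≠ 0 → IsQuotient r P Q → f Q + 1 ≤ f P)
    (hP : IsSignedPoly P) (hP0 : P ≠ 0) : rootMult r P ≤ f P := by
  classical
  let g : (SMax Γ)[X] → ℕ∞ := fun P => if IsSignedPoly P ∧ P ≠ 0 then f P else ⊤
  have hg (P) (h : IsSignedPoly P) (h0 : P ≠ 0) : g P = f P := if_pos ⟨h, h0⟩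
  rw [← hg P hP hP0]
  refine (multStep r).lfp_le (a := g) (fun P => ?_) P
  by_cases hs : IsSignedPoly P ∧ P ≠ 0
  · rw [hg P hs.1 hs.2]
    change (if IsSignedRoot P r then 1 + ⨆ Q : {Q // IsQuotient r P Q}, g Q else 0) ≤ _
    split_ifs with hr
    · obtain ⟨w, hw⟩ : ∃ w, f P = 1 + w := Nat.exists_eq_add_of_le (hroot P hs.1 hs.2 hr)
      rw [hw, Nat.cast_add, Nat.cast_one]
      refine add_le_add le_rfl (iSup_le fun Q => ?_)
      rw [hg Q Q.2.1 (Q.2.ne_zero hs.1 hs.2), Nat.cast_le]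
      have := hquot P Q hs.1 hs.2 Q.2
      lia
    · exact bot_le
  · exact le_top.trans_eq (if_neg hs).symm

theorem IsSigned.rootMult_le_variation (hr : IsSigned r) (hr0 : r ≠ 0) (hP : IsSignedPoly P)
    (hP0 : P ≠ 0) : rootMult r P ≤ variation r P :=
  rootMult_le_of_isQuotient (fun _ hP hP0 h => h.variation_pos hr0 hP hP0)
    (fun _ _ hP hP0 h => h.succ_variation_le hr hr0 hP hP0) hP hP0

theorem IsSignedRoot.natTrailingDegree_pos (h : IsSignedRoot P 0) (hP : IsSignedPoly P)
    (hP0 : P ≠ 0) : 0 < P.natTrailingDegree := by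
  have hcoeff : P.coeff 0 = 0 := by
    rw [coeff_zero_eq_eval_zero]
    exact (coeff_zero_eq_eval_zero P ▸ hP 0).eq_of_balances isSigned_zero h.2
  exact Nat.pos_of_ne_zero fun h0 => (natTrailingDegree_eq_zero.1 h0).elim hP0 (· hcoeff)

theorem IsQuotient.C_mul_eq_X_mul (h : IsQuotient 0 P Q) (hP : IsSignedPoly P) :
    ∃ lam ≠ 0, C lam * P = X * Q := by
  obtain ⟨hQ, lam, hlam, hlam0, hbal⟩ := h
  refine ⟨lam, hlam0, Polynomial.ext fun k => ?_⟩
  have hk := hbal k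
  rw [neg_zero, C_0, add_zero] at hk
  exact (hP.C_mul hlam k).eq_of_balances (hQ.X_mul k) hk

theorem IsQuotient.natTrailingDegree_eq (h : IsQuotient 0 P Q) (hP : IsSignedPoly P)
    (hP0 : P ≠ 0) : Q.natTrailingDegree + 1 = P.natTrailingDegree := by
  obtain ⟨lam, hlam0, heq⟩ := h.C_mul_eq_X_mul hP
  have htrail := congrArg natTrailingDegree heq
  have : Nontrivial (SMax Γ) := ⟨lam, 0, hlam0⟩
  rw [natTrailingDegree_mul (C_ne_zero.2 hlam0) hP0, natTrailingDegree_C, zero_add,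
    natTrailingDegree_mul X_ne_zero (h.ne_zero hP hP0), natTrailingDegree_X] at htrail
  rw [htrail, add_comm]

theorem rootMult_zero_le (hP : IsSignedPoly P) (hP0 : P ≠ 0) :
    rootMult 0 P ≤ TMax.cornerMult (P.map abs) 0 := by
  rw [TMax.cornerMult, if_pos rfl, natTrailingDegree, trailingDegree, support_map_abs]
  exact rootMult_le_of_isQuotient (fun _ hP hP0 h => h.natTrailingDegree_pos hP hP0)
    (fun _ _ hP hP0 h => (h.natTrailingDegree_eq hP hP0).le) hP hP0

theorem IsSigned.rootMult_add_rootMult_neg_le (hr : IsSigned r) (hr0 : r ≠ 0)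
    (hP : IsSignedPoly P) (hP0 : P ≠ 0) :
    rootMult r P + rootMult (SMax.neg r) P ≤ TMax.cornerMult (P.map abs) (abs r) := by
  have hneg0 : SMax.neg r ≠ 0 := by
    rwa [Ne, ← abs_eq_zero, abs_neg, abs_eq_zero]
  calc rootMult r P + rootMult (SMax.neg r) P
      ≤ variation r P + variation (SMax.neg r) P :=
        add_le_add (hr.rootMult_le_variation hr0 hP hP0)
          (hr.neg.rootMult_le_variation hneg0 hP hP0)
    _ ≤ TMax.cornerMult (P.map abs) (abs r) := by
        exact_mod_cast hr.variation_add_variation_neg_le hr0 hP hP0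

theorem IsSigned.rootMult_le_cornerMult (hr : IsSigned r) (hP : IsSignedPoly P) (hP0 : P ≠ 0) :
    rootMult r P ≤ TMax.cornerMult (P.map abs) (abs r) := by
  obtain rfl | hr0 := eq_or_ne r 0
  · rw [map_zero]
    exact rootMult_zero_le hP hP0
  · exact le_self_add.trans (hr.rootMult_add_rootMult_neg_le hr0 hP hP0)

theorem IsSignedRoot.one_le_rootMult (h : IsSignedRoot P r) : 1 ≤ rootMult r P := by
  rw [rootMult_eq, if_pos h]
  exact le_self_add

theorem IsSignedRoot.isCorner (h : IsSignedRoot P r) (hP : IsSignedPoly P) (hP0 : P ≠ 0) :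
    TMax.IsCorner (P.map abs) (abs r) :=
  TMax.isCorner_of_cornerMult_pos
    (by exact_mod_cast h.one_le_rootMult.trans (h.1.rootMult_le_cornerMult hP hP0))

theorem sum_rootMult_le_cornerMult (hP : IsSignedPoly P) (hP0 : P ≠ 0) {c : TMax Γ}
    {s : Finset (SMax Γ)} (hs : ∀ r ∈ s, IsSigned r) (hc : ∀ r ∈ s, abs r = c) :
    ∑ r ∈ s, rootMult r P ≤ TMax.cornerMult (P.map abs) c := by
  classical
  obtain rfl | ⟨r, hr⟩ := s.eq_empty_or_nonempty
  · simp
  obtain rfl := hc r hr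
  obtain rfl | hr0 := eq_or_ne r 0
  · have hsub : s ⊆ {0} := fun a ha =>
      Finset.mem_singleton.2 (abs_eq_zero.1 ((hc a ha).trans (map_zero abs)))
    refine (Finset.sum_le_sum_of_subset hsub).trans ?_
    rw [Finset.sum_singleton]
    exact (hs 0 hr).rootMult_le_cornerMult hP hP0
  · have hsub : s ⊆ {r, neg r} := fun a ha => by
      simpa using (hs a ha).eq_or_eq_neg (hs r hr) (hc a ha)
    have hne : r ≠ neg r := (hs r hr).ne_neg hr0
    refine (Finset.sum_le_sum_of_subset hsub).trans ?_
    rw [Finset.sum_pair hne]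
    exact (hs r hr).rootMult_add_rootMult_neg_le hr0 hP hP0

theorem sum_rootMult_le_natDegree (hP : IsSignedPoly P) (hP0 : P ≠ 0) {s : Finset (SMax Γ)}
    (hs : ∀ r ∈ s, IsSigned r) : ∑ r ∈ s, rootMult r P ≤ P.natDegree := by
  classical
  calc ∑ r ∈ s, rootMult r P
      = ∑ c ∈ s.image abs, ∑ r ∈ s with abs r = c, rootMult r P :=
        (Finset.sum_fiberwise_of_maps_to (fun _ => Finset.mem_image_of_mem abs) _).symm
    _ ≤ ∑ c ∈ s.image abs, (TMax.cornerMult (P.map abs) c : ℕ∞) :=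
        Finset.sum_le_sum fun c _ => sum_rootMult_le_cornerMult hP hP0
          (fun r hr => hs r (Finset.mem_of_mem_filter r hr)) fun r hr => (Finset.mem_filter.1 hr).2
    _ ≤ (P.map abs).natDegree := by
        exact_mod_cast TMax.sum_cornerMult_le_natDegree (map_abs_ne_zero hP0) _
    _ ≤ P.natDegree := by exact_mod_cast natDegree_map_le

theorem finite_setOf_isSignedRoot (hP : IsSignedPoly P) (hP0 : P ≠ 0) :
    {r | IsSignedRoot P r}.Finite := by
  by_contra hinf
  obtain ⟨s, hs, hcard⟩ := Set.Infinite.exists_subset_card_eq hinf (P.natDegree + 1)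
  have hle := sum_rootMult_le_natDegree hP hP0 fun r hr => (hs hr).1
  have hcard_le : (s.card : ℕ∞) ≤ ∑ r ∈ s, rootMult r P := by
    rw [Finset.card_eq_sum_ones, Nat.cast_sum]
    exact Finset.sum_le_sum fun r hr => by
      rw [Nat.cast_one]; exact (hs hr).one_le_rootMult
  rw [hcard] at hcard_le
  exact absurd (hcard_le.trans hle) (by norm_cast; lia)

end SMax

theorem mainTheorem8_general {Γ : Type*} [AddCommGroup Γ] [LinearOrder Γ]
    [IsOrderedAddMonoid Γ] (P : (SMax Γ)[X]) (hP : SMax.IsSignedPoly P) (n : ℕ)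
    (hn : P.degree = n) :
    (∀ r : SMax Γ, SMax.IsSignedRoot P r →
      TMax.IsCorner (P.map SMax.abs) (SMax.abs r) ∧
      SMax.rootMult r P ≤ TMax.cornerMult (P.map SMax.abs) (SMax.abs r)) ∧
    (∀ r : SMax Γ, SMax.IsSignedRoot P r → r ≠ 0 →
      SMax.rootMult r P + SMax.rootMult (SMax.neg r) P
        ≤ TMax.cornerMult (P.map SMax.abs) (SMax.abs r)) ∧
    ∃ hfin : {r : SMax Γ | SMax.IsSignedRoot P r}.Finite,
      ∑ r ∈ hfin.toFinset, SMax.rootMult r P ≤ n := by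
  have hP0 : P ≠ 0 := by
    rintro rfl
    simp at hn
  have hfin := SMax.finite_setOf_isSignedRoot hP hP0
  refine ⟨fun r hr => ⟨hr.isCorner hP hP0, hr.1.rootMult_le_cornerMult hP hP0⟩,
    fun r hr hr0 => hr.1.rootMult_add_rootMult_neg_le hr0 hP hP0, hfin, ?_⟩
  rw [← natDegree_eq_of_degree_eq_some hn]
  exact SMax.sum_rootMult_le_natDegree hP hP0 fun r hr => (hfin.mem_toFinset.1 hr).1

theorem mainTheorem8 {Γ : Type*} [AddCommGroup Γ] [LinearOrder Γ] [IsOrderedAddMonoid Γ]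
    (hdiv : ∀ m : ℕ, 0 < m → ∀ g : Γ, ∃ h : Γ, m • h = g)
    (P : (SMax Γ)[X]) (hP : SMax.IsSignedPoly P) (n : ℕ) (hn : P.degree = n) :
    (∀ r : SMax Γ, SMax.IsSignedRoot P r →
      TMax.IsCorner (P.map SMax.abs) (SMax.abs r) ∧
      SMax.rootMult r P ≤ TMax.cornerMult (P.map SMax.abs) (SMax.abs r)) ∧
    (∀ r : SMax Γ, SMax.IsSignedRoot P r → r ≠ 0 →
      SMax.rootMult r P + SMax.rootMult (SMax.neg r) P
        ≤ TMax.cornerMult (P.map SMax.abs) (SMax.abs r)) ∧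
    ∃ hfin : {r : SMax Γ | SMax.IsSignedRoot P r}.Finite,
      ∑ r ∈ hfin.toFinset, SMax.rootMult r P ≤ n :=
  mainTheorem8_general P hP n hn
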